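/- Theorem. For $n\in\mathbb{N}_0\cup\{\infty\}$ put $(a;q)_n:=\prod_{j=0}^{n-1}(1-aq^j)$ and $(a_1,a_2;q)_\infty:=(a_1;q)_\infty(a_2;q)_\infty$. For positive integers $k$ and $m$, let $$F_{k,m}(q):=\sum_{n\ge 0}\frac{\left(q^{2n+2},q^{2n+2k};q^2\right)_\infty}{\left(q^{2n+1};q^2\right)_\infty^2}\,q^{m(2n+1)}=\sum_{n\ge 0}c_{k,m}(n)q^n,$$ regarded as a formal power series in $q$. Then for every $k\in\{8,9,10\}$ all coefficients of $F_{k,1}(q)$ are nonnegative, that is, $c_{k,1}(n)\ge 0$ for all integers $n\ge 0$. -/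

import Mathlib

open PowerSeries
open scoped PowerSeries.WithPiTopology

noncomputable section

namespace TwoColor

/-- The infinite `q`-Pochhammer symbol `(a; b)_∞ = ∏_{j ≥ 0} (1 - a b ^ j)` of formal power
series `a`, `b` in the indeterminate `q` (written `X`). The infinite product is taken in the
topology of coefficientwise convergence. -/
def qPochInf (a b : ℚ⟦X⟧) : ℚ⟦X⟧ := ∏' j : ℕ, (1 - a * b ^ j)

/-- The `n`-th summand
`(q^(2n+2), q^(2n+2k); q^2)_∞ / (q^(2n+1); q^2)_∞ ^ 2 * q^(m(2n+1))`. -/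
def summand (k m n : ℕ) : ℚ⟦X⟧ :=
  qPochInf (X ^ (2 * n + 2)) (X ^ 2) * qPochInf (X ^ (2 * n + 2 * k)) (X ^ 2) *
    (qPochInf (X ^ (2 * n + 1)) (X ^ 2) ^ 2)⁻¹ * X ^ (m * (2 * n + 1))

/-- The formal power series `F_{k,m}(q)`, the sum over `n ≥ 0` of the above summands, in the
topology of coefficientwise convergence. -/
def F (k m : ℕ) : ℚ⟦X⟧ := ∑' n : ℕ, summand k m n

/-! The facts below show that the infinite products and sums above converge and that the
denominators are invertible, so that no default value occurs for `k, m ≥ 1`. -/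

theorem multipliable_qPochInf (r : ℕ) :
    Multipliable fun j : ℕ => (1 - X ^ r * (X ^ 2) ^ j : ℚ⟦X⟧) := by
  have h : Multipliable fun j : ℕ => (1 + -(X ^ r * (X ^ 2) ^ j) : ℚ⟦X⟧) := by
    apply WithPiTopology.multipliable_one_add_of_tendsto_order_atTop_nhds_top
    refine ENat.tendsto_nhds_top_iff_natCast_lt.mpr fun N => ?_
    filter_upwards [Filter.eventually_gt_atTop N] with j hj
    rw [order_neg, ← pow_mul, ← pow_add, order_X_pow]
    exact_mod_cast (by omega : N < r + 2 * j)
  simpa only [← sub_eq_add_neg] using h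

theorem constantCoeff_qPochInf (r : ℕ) (hr : 1 ≤ r) :
    constantCoeff (qPochInf (X ^ r) (X ^ 2)) = 1 := by
  unfold qPochInf
  rw [(multipliable_qPochInf r).map_tprod (constantCoeff (R := ℚ))
    (WithPiTopology.continuous_constantCoeff ℚ)]
  have h : ∀ j : ℕ, constantCoeff (1 - X ^ r * (X ^ 2) ^ j : ℚ⟦X⟧) = 1 := by
    intro j
    simp [show r ≠ 0 by omega]
  simp [h]

theorem qPochInf_sq_mul_inv (r : ℕ) (hr : 1 ≤ r) :
    qPochInf (X ^ r) (X ^ 2) ^ 2 * (qPochInf (X ^ r) (X ^ 2) ^ 2)⁻¹ = 1 := by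
  apply PowerSeries.mul_inv_cancel
  simp [constantCoeff_qPochInf r hr]

theorem summable_summand (k m : ℕ) (hm : 1 ≤ m) : Summable (summand k m) := by
  apply WithPiTopology.summable_of_tendsto_order_atTop_nhds_top
  refine ENat.tendsto_nhds_top_iff_natCast_lt.mpr fun N => ?_
  filter_upwards [Filter.eventually_gt_atTop N] with n hn
  have h2 : ((m * (2 * n + 1) : ℕ) : ℕ∞) ≤ (summand k m n).order := by
    apply le_trans _ (le_order_mul _ _)
    rw [order_X_pow]
    exact le_add_self
  refine lt_of_lt_of_le ?_ h2
  exact_mod_cast (by nlinarith : N < m * (2 * n + 1))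

end TwoColor

end

namespace TwoColor

/-! ### Convergence of families of power series -/

/-! Write $(a)_n$ for $(a;q^2)_n$. Two applications of the $q$-binomial theorem, with an exchange of
sums between them (a Heine transformation), give
$F_{k,1}=\sum_{m\ge0}\frac{(q^{2k-1})_m}{(q)_{m+1}}q^{m+1}$ (`F_one_eq_tsum`). With $K=k-2$,
regrouping the odd factors turns this into $(q)_{K+1}F_{k,1}=q\sum_n q^n(q^{2n+3})_K$
(`fpoch_mul_F`). The last sum is a finite combination of geometric series, so $F_{k,1}$ is a
rational function with denominator $(q)_{K+1}^2$ (`oneSubs_odds_sq_mul_F`).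

For each of the three $k$ there are a list $A$ and a period $s$ such that $F_{k,1}\prod_{a\in
A}(1-q^a)=P+R/(1-q^s)$ with $P,R$ polynomials having nonnegative coefficients. Dividing by the
factors $1-q^a$ preserves nonnegativity (`coeff_F_nonneg_of_isCertificate`). The identity, cleared
of denominators, is a finite computation with integer lists. -/

theorem summable_of_X_pow_dvd {ι : Type*} {f : ι → ℚ⟦X⟧} (w : ι → ℕ)
    (hw : ∀ n, {i | w i ≤ n}.Finite) (h : ∀ i, X ^ w i ∣ f i) : Summable f := by
  refine (WithPiTopology.summable_iff_summable_coeff ℚ).mpr fun n =>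
    summable_of_hasFiniteSupport ((hw n).subset ?_)
  intro i hi
  by_contra hlt
  exact hi (X_pow_dvd_iff.mp (h i) n (not_le.mp hlt))

theorem finite_setOf_le_of_le {w : ℕ → ℕ} (hw : ∀ n, n ≤ w n) (N : ℕ) : {n | w n ≤ N}.Finite :=
  (Set.finite_Iic N).subset fun n hn => (hw n).trans hn

theorem eq_zero_of_forall_X_pow_dvd {f : ℚ⟦X⟧} (h : ∀ n, ∃ m, n < m ∧ X ^ m ∣ f) : f = 0 := by
  ext n
  obtain ⟨m, hm, hd⟩ := h n
  simpa using X_pow_dvd_iff.mp hd n hm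

/-! ### The infinite `q`-Pochhammer symbol with base `X ^ 2` -/

/-- `(q^r; q^2)_∞`. -/
noncomputable abbrev poch (r : ℕ) : ℚ⟦X⟧ := qPochInf (X ^ r) (X ^ 2)

theorem poch_eq (r : ℕ) : poch r = (1 - X ^ r) * poch (r + 2) := by
  unfold poch qPochInf
  have h := multipliable_qPochInf (r + 2)
  have e : ∀ j : ℕ, (1 - X ^ r * (X ^ 2) ^ (j + 1) : ℚ⟦X⟧) = 1 - X ^ (r + 2) * (X ^ 2) ^ j := by
    intro j; ring
  rw [tprod_eq_zero_mul' (by simpa only [e] using h)]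
  simp only [e, pow_zero, mul_one]

/-- Every finite partial product is $1$ modulo $X^r$, and coefficients are continuous. -/
theorem X_pow_dvd_poch_sub_one (r : ℕ) : X ^ r ∣ poch r - 1 := by
  rw [X_pow_dvd_iff]
  intro m hm
  have hp := (multipliable_qPochInf r).hasProd
  have hc := (((WithPiTopology.continuous_coeff ℚ m).tendsto _).comp hp)
  have hconst : ∀ s : Finset ℕ,
      coeff m (∏ j ∈ s, (1 - X ^ r * (X ^ 2) ^ j : ℚ⟦X⟧)) = coeff m (1 : ℚ⟦X⟧) := by
    intro s
    have hd : (X : ℚ⟦X⟧) ^ r ∣ ∏ j ∈ s, (1 - X ^ r * (X ^ 2) ^ j : ℚ⟦X⟧) - 1 := by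
      induction s using Finset.induction_on with
      | empty => simp
      | insert a s ha ih =>
        rw [Finset.prod_insert ha]
        obtain ⟨c, hc⟩ := ih
        refine ⟨c - (X ^ 2) ^ a * ∏ j ∈ s, (1 - X ^ r * (X ^ 2) ^ j : ℚ⟦X⟧), ?_⟩
        linear_combination hc
    have := X_pow_dvd_iff.mp hd m hm
    rwa [map_sub, sub_eq_zero] at this
  have hc' : Filter.Tendsto (fun _ : Finset ℕ => coeff m (1 : ℚ⟦X⟧))
      (SummationFilter.unconditional ℕ).filter (nhds (coeff m (poch r))) := by
    refine hc.congr fun s => ?_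
    exact hconst s
  have := tendsto_nhds_unique hc' tendsto_const_nhds
  rw [map_sub, this, sub_self]

theorem isUnit_poch {r : ℕ} (hr : 1 ≤ r) : IsUnit (poch r) := by
  rw [PowerSeries.isUnit_iff_constantCoeff, constantCoeff_qPochInf r hr]
  exact isUnit_one

/-! ### The finite `q`-Pochhammer symbol with base `X ^ 2` -/

/-- `(q^r; q^2)_n`. -/
noncomputable def fpoch (r n : ℕ) : ℚ⟦X⟧ := ∏ j ∈ Finset.range n, (1 - X ^ (r + 2 * j))

theorem fpoch_succ (r n : ℕ) : fpoch r (n + 1) = fpoch r n * (1 - X ^ (r + 2 * n)) :=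
  Finset.prod_range_succ _ _

@[simp] theorem fpoch_zero (r : ℕ) : fpoch r 0 = 1 := rfl

theorem fpoch_add (r m n : ℕ) : fpoch r (m + n) = fpoch r m * fpoch (r + 2 * m) n := by
  unfold fpoch
  rw [Finset.prod_range_add]
  congr 1
  exact Finset.prod_congr rfl fun j _ => by ring

theorem poch_eq_fpoch_mul (r n : ℕ) : poch r = fpoch r n * poch (r + 2 * n) := by
  induction n with
  | zero => simp
  | succ n ih =>
    rw [ih, fpoch_succ, poch_eq (r + 2 * n)]
    ring_nf

theorem constantCoeff_fpoch {r : ℕ} (hr : 1 ≤ r) (n : ℕ) : constantCoeff (fpoch r n) = 1 := by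
  unfold fpoch
  rw [map_prod]
  refine Finset.prod_eq_one fun j _ => ?_
  rw [map_sub, map_one, map_pow, constantCoeff_X, zero_pow (by omega), sub_zero]

theorem isUnit_fpoch {r : ℕ} (hr : 1 ≤ r) (n : ℕ) : IsUnit (fpoch r n) := by
  rw [PowerSeries.isUnit_iff_constantCoeff, constantCoeff_fpoch hr]
  exact isUnit_one

theorem fpoch_mul_inv {r : ℕ} (hr : 1 ≤ r) (n : ℕ) : fpoch r n * (fpoch r n)⁻¹ = 1 :=
  PowerSeries.mul_inv_cancel _ (by simp [constantCoeff_fpoch hr])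

/-! ### The `q`-binomial theorem -/

/-- The `q`-binomial coefficient series `(q^s; q^2)_m / (q^2; q^2)_m`. -/
noncomputable def binomCoeff (s m : ℕ) : ℚ⟦X⟧ := fpoch s m * (fpoch 2 m)⁻¹

theorem binomCoeff_mul (s m : ℕ) : binomCoeff s m * fpoch 2 m = fpoch s m := by
  rw [binomCoeff, mul_assoc, mul_comm _ (fpoch 2 m), fpoch_mul_inv (by norm_num), mul_one]

theorem binomCoeff_succ (s m : ℕ) :
    binomCoeff s (m + 1) * (1 - X ^ (2 * m + 2)) = binomCoeff s m * (1 - X ^ (s + 2 * m)) := by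
  apply (isUnit_fpoch (r := 2) (by norm_num) m).mul_right_cancel
  have h1 := binomCoeff_mul s (m + 1)
  have h2 := binomCoeff_mul s m
  rw [fpoch_succ, fpoch_succ] at h1
  rw [show 2 * m + 2 = 2 + 2 * m by ring]
  linear_combination h1 - (1 - X ^ (s + 2 * m)) * h2

/-- `∑ (q^s; q^2)_m / (q^2; q^2)_m q^(r m)`. -/
noncomputable def binomSeries (s r : ℕ) : ℚ⟦X⟧ := ∑' m : ℕ, binomCoeff s m * X ^ (r * m)

theorem summable_mul_X_pow_mul (c : ℕ → ℚ⟦X⟧) {r : ℕ} (hr : 1 ≤ r) :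
    Summable fun m => c m * X ^ (r * m) :=
  summable_of_X_pow_dvd (fun m => r * m)
    (finite_setOf_le_of_le fun n => Nat.le_mul_of_pos_left n hr) fun _ => Dvd.intro_left _ rfl

theorem X_pow_dvd_binomSeries_sub_one (s : ℕ) {r : ℕ} (hr : 1 ≤ r) :
    X ^ r ∣ binomSeries s r - 1 := by
  have hs := summable_mul_X_pow_mul (binomCoeff s) hr
  have hs' := summable_mul_X_pow_mul (fun m => binomCoeff s (m + 1)) hr
  refine ⟨∑' m : ℕ, binomCoeff s (m + 1) * X ^ (r * m), ?_⟩
  rw [binomSeries, hs.tsum_eq_zero_add, ← hs'.tsum_mul_left]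
  have e : ∀ m : ℕ, (X : ℚ⟦X⟧) ^ r * (binomCoeff s (m + 1) * X ^ (r * m))
      = binomCoeff s (m + 1) * X ^ (r * (m + 1)) := by intro m; ring
  simp only [e]
  simp [binomCoeff]

/-- The $m$-th term of the difference of the series at $r$ and $r+2$ carries a factor $1-q^{2m}$,
which `binomCoeff_succ` trades for the previous coefficient. -/
theorem binomSeries_eq (s : ℕ) {r : ℕ} (hr : 1 ≤ r) :
    (1 - X ^ r) * binomSeries s r = (1 - X ^ (r + s)) * binomSeries s (r + 2) := by
  have h1 := summable_mul_X_pow_mul (binomCoeff s) hr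
  have h2 := summable_mul_X_pow_mul (binomCoeff s) (show 1 ≤ r + 2 by omega)
  have h3 : binomSeries s r - binomSeries s (r + 2)
      = X ^ r * binomSeries s r - X ^ (r + s) * binomSeries s (r + 2) := by
    unfold binomSeries
    rw [← h1.tsum_mul_left, ← h2.tsum_mul_left, ← h1.tsum_sub h2,
      ← (h1.mul_left _).tsum_sub (h2.mul_left _), (h1.sub h2).tsum_eq_zero_add]
    simp only [mul_zero, sub_self, zero_add]
    refine tsum_congr fun m => ?_
    have := binomCoeff_succ s m
    linear_combination X ^ (r * (m + 1)) * this
  linear_combination h3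

/-- The $q$-binomial theorem. Raising $r$ by $2$ multiplies both sides by inverse factors of the
same kind, so their difference is divisible by arbitrarily high powers of $X$. -/
theorem binomSeries_mul_poch (s : ℕ) {r : ℕ} (hr : 1 ≤ r) :
    binomSeries s r * poch r = poch (r + s) := by
  rw [← sub_eq_zero]
  have key : ∀ J r : ℕ, 1 ≤ r → X ^ (r + 2 * J) ∣ binomSeries s r * poch r - poch (r + s) := by
    intro J
    induction J with
    | zero =>
      intro r hr
      obtain ⟨a, ha⟩ := X_pow_dvd_binomSeries_sub_one s hr
      obtain ⟨b, hb⟩ := X_pow_dvd_poch_sub_one r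
      obtain ⟨c, hc⟩ := X_pow_dvd_poch_sub_one (r + s)
      refine ⟨a * poch r + b - X ^ s * c, ?_⟩
      rw [mul_zero, add_zero]
      rw [pow_add] at hc
      linear_combination poch r * ha + hb - hc
    | succ J ih =>
      intro r hr
      obtain ⟨c, hc⟩ := ih (r + 2) (by omega)
      refine ⟨(1 - X ^ (r + s)) * c, ?_⟩
      rw [poch_eq r, poch_eq (r + s)]
      rw [show r + 2 * (J + 1) = r + 2 + 2 * J by ring]
      rw [show r + 2 + s = r + s + 2 by ring] at hc
      linear_combination poch (r + 2) * binomSeries_eq s hr + (1 - X ^ (r + s)) * hc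
  exact eq_zero_of_forall_X_pow_dvd fun n => ⟨r + 2 * (n + 1), by omega, key _ _ hr⟩

/-! ### Heine's transformation of the series -/

/-- The quotient $(q^{2n+2k})_\infty/(q^{2n+1})_\infty$ is expanded by the $q$-binomial theorem; the
other quotient is $(q^2)_\infty/(q)_\infty$ times `binomCoeff 1 n`. -/
theorem summand_eq {k : ℕ} (hk : 1 ≤ k) (n : ℕ) :
    poch 1 * summand k 1 n =
      poch 2 * ∑' m : ℕ,
        binomCoeff 1 n * binomCoeff (2 * k - 1) m * X ^ ((2 * n + 1) * (m + 1)) := by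
  have hs := summable_mul_X_pow_mul (binomCoeff (2 * k - 1)) (show 1 ≤ 2 * n + 1 by omega)
  have e : ∀ m : ℕ, binomCoeff 1 n * binomCoeff (2 * k - 1) m * X ^ ((2 * n + 1) * (m + 1))
      = (binomCoeff 1 n * X ^ (2 * n + 1)) *
        (binomCoeff (2 * k - 1) m * X ^ ((2 * n + 1) * m)) := by
    intro m; ring
  simp only [e]
  rw [hs.tsum_mul_left]
  have hb := binomSeries_mul_poch (2 * k - 1) (show 1 ≤ 2 * n + 1 by omega)
  rw [show 2 * n + 1 + (2 * k - 1) = 2 * n + 2 * k by omega] at hb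
  have hinv := qPochInf_sq_mul_inv (2 * n + 1) (by omega)
  have h1 := poch_eq_fpoch_mul 1 n
  have h2 := poch_eq_fpoch_mul 2 n
  have h3 := binomCoeff_mul 1 n
  rw [show 1 + 2 * n = 2 * n + 1 by ring] at h1
  rw [show 2 + 2 * n = 2 * n + 2 by ring] at h2
  change _ = poch 2 * (binomCoeff 1 n * X ^ (2 * n + 1) * binomSeries (2 * k - 1) (2 * n + 1))
  unfold summand
  change poch 1 * (poch (2 * n + 2) * poch (2 * n + 2 * k) *
    (poch (2 * n + 1) ^ 2)⁻¹ * X ^ (1 * (2 * n + 1))) = _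
  rw [← hb]
  rw [h1, h2, ← h3, one_mul]
  linear_combination (binomCoeff 1 n * fpoch 2 n * poch (2 * n + 2) *
    binomSeries (2 * k - 1) (2 * n + 1) * X ^ (2 * n + 1)) * hinv

theorem F_one_eq_tsum {k : ℕ} (hk : 1 ≤ k) :
    F k 1 = ∑' m : ℕ, fpoch (2 * k - 1) m * (fpoch 1 (m + 1))⁻¹ * X ^ (m + 1) := by
  have hsum : Summable (Function.uncurry fun n m : ℕ =>
      binomCoeff 1 n * binomCoeff (2 * k - 1) m * X ^ ((2 * n + 1) * (m + 1))) := by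
    refine summable_of_X_pow_dvd (fun p => (2 * p.1 + 1) * (p.2 + 1)) (fun N => ?_)
      fun _ => Dvd.intro_left _ rfl
    refine ((Set.finite_Iic N).prod (Set.finite_Iic N)).subset ?_
    rintro ⟨a, b⟩ h
    simp only [Set.mem_ofPred_eq, Set.mem_prod, Set.mem_Iic] at h ⊢
    constructor <;> nlinarith
  have hrow : ∀ n : ℕ, Summable fun m : ℕ =>
      binomCoeff 1 n * binomCoeff (2 * k - 1) m * X ^ ((2 * n + 1) * (m + 1)) := fun n =>
    summable_of_X_pow_dvd (fun m => (2 * n + 1) * (m + 1))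
      (finite_setOf_le_of_le fun m => by nlinarith) fun _ => Dvd.intro_left _ rfl
  have hcol : ∀ m : ℕ, Summable fun n : ℕ =>
      binomCoeff 1 n * binomCoeff (2 * k - 1) m * X ^ ((2 * n + 1) * (m + 1)) := fun m =>
    summable_of_X_pow_dvd (fun n => (2 * n + 1) * (m + 1))
      (finite_setOf_le_of_le fun n => by nlinarith) fun _ => Dvd.intro_left _ rfl
  have hrow' := (hsum.hasSum.prod_fiberwise fun n => (hrow n).hasSum).summable
  have hcol' := (hsum.prod_symm.hasSum.prod_fiberwise fun m => (hcol m).hasSum).summable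
  apply (isUnit_poch le_rfl).mul_left_cancel
  have hR : Summable fun m : ℕ => fpoch (2 * k - 1) m * (fpoch 1 (m + 1))⁻¹ * X ^ (m + 1) :=
    summable_of_X_pow_dvd (fun m => m + 1) (finite_setOf_le_of_le fun n => by omega)
      fun _ => Dvd.intro_left _ rfl
  -- The double sum is reordered so that the sum over $n$ becomes the inner one, a second
  -- $q$-binomial series.
  rw [F, ← (summable_summand k 1 le_rfl).tsum_mul_left, tsum_congr (summand_eq hk),
    hrow'.tsum_mul_left, ← hsum.tsum_comm' hrow hcol, ← hR.tsum_mul_left,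
    ← hcol'.tsum_mul_left]
  refine tsum_congr fun m => ?_
  have e : ∀ n : ℕ, binomCoeff 1 n * binomCoeff (2 * k - 1) m * X ^ ((2 * n + 1) * (m + 1))
      = binomCoeff (2 * k - 1) m * X ^ (m + 1) * (binomCoeff 1 n * X ^ ((2 * m + 2) * n)) := by
    intro n; ring
  simp only [e]
  rw [(summable_mul_X_pow_mul (binomCoeff 1) (show 1 ≤ 2 * m + 2 by omega)).tsum_mul_left]
  change poch 2 * (binomCoeff (2 * k - 1) m * X ^ (m + 1) * binomSeries 1 (2 * m + 2)) = _
  have hb := binomSeries_mul_poch 1 (show 1 ≤ 2 * m + 2 by omega)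
  have h1 := poch_eq_fpoch_mul 1 (m + 1)
  have h2 := poch_eq_fpoch_mul 2 m
  rw [show 1 + 2 * (m + 1) = 2 * m + 3 by ring] at h1
  rw [show 2 + 2 * m = 2 * m + 2 by ring] at h2
  rw [h1, ← binomCoeff_mul (2 * k - 1) m, h2, ← hb]
  linear_combination -(binomCoeff (2 * k - 1) m * X ^ (m + 1) * fpoch 2 m *
    binomSeries 1 (2 * m + 2) * poch (2 * m + 2)) * fpoch_mul_inv (r := 1) le_rfl (m + 1)

/-- `∑ q^(e n) (q^(2n+3); q^2)_K`. -/
noncomputable def finSeries (K e : ℕ) : ℚ⟦X⟧ := ∑' n : ℕ, fpoch (2 * n + 3) K * X ^ (e * n)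

theorem fpoch_mul_F {K : ℕ} : fpoch 1 (K + 1) * F (K + 2) 1 = X * finSeries K 1 := by
  have hR : Summable fun m : ℕ =>
      fpoch (2 * (K + 2) - 1) m * (fpoch 1 (m + 1))⁻¹ * X ^ (m + 1) :=
    summable_of_X_pow_dvd (fun m => m + 1) (finite_setOf_le_of_le fun n => by omega)
      fun _ => Dvd.intro_left _ rfl
  rw [F_one_eq_tsum (by omega), ← hR.tsum_mul_left, finSeries,
    ← (summable_mul_X_pow_mul (fun n => fpoch (2 * n + 3) K) le_rfl).tsum_mul_left]
  refine tsum_congr fun m => ?_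
  -- Both products equal $(q)_{K+1+m}$, split after $K+1$ or after $m+1$ factors.
  have h1 := fpoch_add 1 (K + 1) m
  have h2 := fpoch_add 1 (m + 1) K
  rw [show 1 + 2 * (K + 1) = 2 * (K + 2) - 1 by omega] at h1
  rw [show 1 + 2 * (m + 1) = 2 * m + 3 by omega, show m + 1 + K = K + 1 + m by ring] at h2
  linear_combination -((fpoch 1 (m + 1))⁻¹ * X ^ (m + 1)) * h1
    + ((fpoch 1 (m + 1))⁻¹ * X ^ (m + 1)) * h2
    + (fpoch (2 * m + 3) K * X ^ (m + 1)) * fpoch_mul_inv (r := 1) le_rfl (m + 1)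

theorem finSeries_zero {e : ℕ} (he : 1 ≤ e) : (1 - X ^ e) * finSeries 0 e = 1 := by
  have h := WithPiTopology.one_sub_mul_tsum_pow_of_constantCoeff_eq_zero
    (f := (X : ℚ⟦X⟧) ^ e) (by simp [show e ≠ 0 by omega])
  simpa [finSeries, pow_mul] using h

/-- In the last factor $1-X^{2n+3+2K}$ the part $X^{2n}$ is absorbed by raising $e$ to $e+2$. -/
theorem finSeries_succ (K : ℕ) {e : ℕ} (he : 1 ≤ e) :
    finSeries (K + 1) e = finSeries K e - X ^ (2 * K + 3) * finSeries K (e + 2) := by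
  have h1 := summable_mul_X_pow_mul (fun n => fpoch (2 * n + 3) K) he
  have h2 := summable_mul_X_pow_mul (fun n => fpoch (2 * n + 3) K) (show 1 ≤ e + 2 by omega)
  unfold finSeries
  rw [← h2.tsum_mul_left, ← h1.tsum_sub (h2.mul_left _)]
  refine tsum_congr fun n => ?_
  rw [fpoch_succ]
  ring

/-! ### Integer polynomials as coefficient lists -/

/-- The power series with the given initial coefficients. -/
noncomputable def toSeries : List ℤ → ℚ⟦X⟧
  | [] => 0
  | a :: l => C (a : ℚ) + X * toSeries l

/-- Sum of coefficient lists. -/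
def addL : List ℤ → List ℤ → List ℤ
  | [], m => m
  | a :: l, [] => a :: l
  | a :: l, b :: m => (a + b) :: addL l m

/-- Difference of coefficient lists. -/
def subL : List ℤ → List ℤ → List ℤ
  | [], m => m.map fun b => -b
  | a :: l, [] => a :: l
  | a :: l, b :: m => (a - b) :: subL l m

/-- Multiplication by `X ^ e`. -/
def shiftL (e : ℕ) (l : List ℤ) : List ℤ := List.replicate e 0 ++ l

/-- Multiplication by `∏ (1 - X ^ e)` over the list `es`. -/
def mulOneSubs (es : List ℕ) (l : List ℤ) : List ℤ :=
  es.foldr (fun e m => subL m (shiftL e m)) l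

/-- The first `n` coefficients of the quotient by `1 - X ^ e`. -/
def divOneSub (e : ℕ) : ℕ → List ℤ → List ℤ
  | 0, _ => []
  | n + 1, [] => 0 :: divOneSub e n []
  -- The shift is `e - 1` because the head has already been removed.
  | n + 1, a :: l => a :: divOneSub e n (addL l (shiftL (e - 1) [a]))

theorem toSeries_addL (l m : List ℤ) : toSeries (addL l m) = toSeries l + toSeries m := by
  induction l, m using addL.induct with
  | case1 m => simp [addL, toSeries]
  | case2 a l => simp [addL, toSeries]
  | case3 a l b m ih =>
    simp only [addL, toSeries, ih, Int.cast_add, map_add]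
    ring

theorem toSeries_map_neg (l : List ℤ) : toSeries (l.map fun b => -b) = -toSeries l := by
  induction l with
  | nil => simp [toSeries]
  | cons a l ih =>
    simp only [List.map_cons, toSeries, ih, Int.cast_neg, map_neg]
    ring

theorem toSeries_subL (l m : List ℤ) : toSeries (subL l m) = toSeries l - toSeries m := by
  induction l, m using subL.induct with
  | case1 m => simp [subL, toSeries, toSeries_map_neg]
  | case2 a l => simp [subL, toSeries]
  | case3 a l b m ih =>
    simp only [subL, toSeries, ih, Int.cast_sub, map_sub]
    ring

theorem toSeries_shiftL (e : ℕ) (l : List ℤ) : toSeries (shiftL e l) = X ^ e * toSeries l := by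
  unfold shiftL
  induction e with
  | zero => simp
  | succ e ih =>
    rw [List.replicate_succ, List.cons_append, toSeries, ih]
    simp [pow_succ']
    ring

/-- `∏ (1 - X ^ e)` over the list `es`. -/
noncomputable def oneSubs (es : List ℕ) : ℚ⟦X⟧ := (es.map fun e => (1 - X ^ e : ℚ⟦X⟧)).prod

theorem oneSubs_cons (e : ℕ) (es : List ℕ) : oneSubs (e :: es) = (1 - X ^ e) * oneSubs es := by
  simp [oneSubs]

theorem toSeries_mulOneSubs (es : List ℕ) (l : List ℤ) :
    toSeries (mulOneSubs es l) = oneSubs es * toSeries l := by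
  induction es with
  | nil => simp [mulOneSubs, oneSubs]
  | cons e es ih =>
    rw [oneSubs_cons]
    change toSeries (subL (mulOneSubs es l) (shiftL e (mulOneSubs es l))) = _
    rw [toSeries_subL, toSeries_shiftL, ih]
    ring

theorem oneSubs_erase {e : ℕ} {es : List ℕ} (h : e ∈ es) :
    (1 - X ^ e) * oneSubs (es.erase e) = oneSubs es := by
  rw [← oneSubs_cons]
  exact ((List.perm_cons_erase h).symm.map _).prod_eq

theorem toSeries_eq_zero {l : List ℤ} (h : ∀ a ∈ l, a = 0) : toSeries l = 0 := by
  induction l with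
  | nil => rfl
  | cons a l ih =>
    rw [toSeries, ih fun b hb => h b (List.mem_cons_of_mem _ hb), h a List.mem_cons_self]
    simp

/-! ### Nonnegative coefficients -/

theorem coeff_toSeries_nonneg {l : List ℤ} (h : ∀ a ∈ l, 0 ≤ a) (n : ℕ) :
    0 ≤ coeff n (toSeries l) := by
  induction l generalizing n with
  | nil => simp [toSeries]
  | cons a l ih =>
    have ha : (0 : ℚ) ≤ a := by exact_mod_cast h a List.mem_cons_self
    have hl := ih fun b hb => h b (List.mem_cons_of_mem _ hb)
    rcases n with _ | n
    · simpa [toSeries] using ha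
    · rw [toSeries, map_add, coeff_succ_X_mul, coeff_C, if_neg n.succ_ne_zero, zero_add]
      exact hl n

/-- Each coefficient of $f$ is that of $(1-X^e)f$ plus the coefficient of $f$ that lies $e$ places
earlier. -/
theorem coeff_nonneg_of_one_sub_mul {e : ℕ} (he : 1 ≤ e) {f : ℚ⟦X⟧}
    (h : ∀ n, 0 ≤ coeff n ((1 - X ^ e) * f)) (n : ℕ) : 0 ≤ coeff n f := by
  induction n using Nat.strong_induction_on with
  | _ n ih =>
    have hn := h n
    rw [sub_mul, one_mul, map_sub, coeff_X_pow_mul'] at hn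
    split_ifs at hn with hle
    · have := ih (n - e) (by omega)
      linarith
    · simpa using hn

theorem coeff_nonneg_of_oneSubs_mul {es : List ℕ} (he : ∀ e ∈ es, 1 ≤ e) {f : ℚ⟦X⟧}
    (h : ∀ n, 0 ≤ coeff n (oneSubs es * f)) : ∀ n, 0 ≤ coeff n f := by
  induction es with
  | nil => simpa [oneSubs] using h
  | cons e es ih =>
    refine ih (fun d hd => he d (List.mem_cons_of_mem _ hd)) ?_
    rw [oneSubs_cons] at h
    simp only [mul_assoc] at h
    exact coeff_nonneg_of_one_sub_mul (he e List.mem_cons_self) h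

/-! ### The series `F` as a rational function -/

/-- The coefficients of the polynomial `(∏ (1 - X ^ d)) * finSeries K e`, the product being over
`d` in `es`. -/
def finList (es : List ℕ) : ℕ → ℕ → List ℤ
  | 0, e => mulOneSubs (es.erase e) [1]
  | K + 1, e => subL (finList es K e) (shiftL (2 * K + 3) (finList es K (e + 2)))

/-- Unfolding the recursion produces only the denominators $1-X^{e+2i}$ with $i\le K$, one per term,
so each must occur in `es`. -/
theorem toSeries_finList {es : List ℕ} (K : ℕ) {e : ℕ} (he : 1 ≤ e)
    (h : ∀ i ≤ K, e + 2 * i ∈ es) :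
    toSeries (finList es K e) = oneSubs es * finSeries K e := by
  induction K generalizing e with
  | zero =>
    rw [finList, toSeries_mulOneSubs, ← oneSubs_erase (h 0 le_rfl)]
    simp only [toSeries, Int.cast_one, map_one, mul_zero, add_zero]
    linear_combination (-oneSubs (es.erase e)) * finSeries_zero he
  | succ K ih =>
    rw [finList, toSeries_subL, toSeries_shiftL, ih he fun i hi => h i (by omega),
      ih (by omega) fun i hi => by
        have := h (i + 1) (by omega)
        rwa [show e + 2 * (i + 1) = e + 2 + 2 * i by ring] at this,
      finSeries_succ K he]
    ring

/-- The odd numbers `1, 3, …, 2 K + 1`. -/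
def odds (K : ℕ) : List ℕ := (List.range (K + 1)).map fun j => 1 + 2 * j

theorem oneSubs_odds (K : ℕ) : oneSubs (odds K) = fpoch 1 (K + 1) := by
  rw [oneSubs, odds, fpoch, List.map_map, Finset.prod_range]
  rw [← List.prod_ofFn, List.ofFn_eq_map, ← List.map_coe_finRange_eq_range, List.map_map]
  rfl

theorem oneSubs_odds_sq_mul_F (K : ℕ) :
    oneSubs (odds K ++ odds K) * F (K + 2) 1 = X * toSeries (finList (odds K) K 1) := by
  have h : toSeries (finList (odds K) K 1) = oneSubs (odds K) * finSeries K 1 := by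
    refine toSeries_finList K le_rfl fun i hi => List.mem_map.mpr ⟨i, ?_, rfl⟩
    rw [List.mem_range]
    omega
  have hs : oneSubs (odds K ++ odds K) = oneSubs (odds K) * oneSubs (odds K) := by
    simp [oneSubs]
  rw [h, hs, oneSubs_odds]
  linear_combination fpoch 1 (K + 1) * fpoch_mul_F (K := K)

/-- `F (K + 2) 1 = (P + R / (1 - X ^ s)) / ∏ (1 - X ^ a)` with nonnegative polynomials `P`, `R`,
the product being over `a` in `A`. -/
def IsCertificate (K s : ℕ) (A : List ℕ) (P R : List ℤ) : Bool :=
  (P ++ R).all (fun a => decide (0 ≤ a)) &&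
    (subL (shiftL 1 (mulOneSubs (s :: A) (finList (odds K) K 1)))
      (mulOneSubs (odds K ++ odds K) (addL (mulOneSubs [s] P) R))).all fun a => decide (a = 0)

theorem isUnit_oneSubs_odds (K : ℕ) : IsUnit (oneSubs (odds K)) := by
  rw [oneSubs_odds]
  exact isUnit_fpoch le_rfl _

theorem coeff_F_nonneg_of_isCertificate {K s : ℕ} {A : List ℕ} {P R : List ℤ} (hs : 1 ≤ s)
    (hA : ∀ a ∈ A, 1 ≤ a) (h : IsCertificate K s A P R = true) (n : ℕ) :
    0 ≤ coeff n (F (K + 2) 1) := by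
  simp only [IsCertificate, Bool.and_eq_true, List.all_eq_true, decide_eq_true_eq,
    List.mem_append] at h
  obtain ⟨hnn, hz⟩ := h
  have hP := coeff_toSeries_nonneg fun a ha => hnn a (Or.inl ha)
  have hR := coeff_toSeries_nonneg fun a ha => hnn a (Or.inr ha)
  have hz' := toSeries_eq_zero hz
  have hu : IsUnit (oneSubs (odds K ++ odds K)) := by
    have := (isUnit_oneSubs_odds K).mul (isUnit_oneSubs_odds K)
    simpa [oneSubs] using this
  have hF := oneSubs_odds_sq_mul_F K
  simp only [toSeries_subL, toSeries_shiftL, toSeries_mulOneSubs, toSeries_addL, oneSubs_cons,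
    pow_one] at hz'
  have hnil : oneSubs [] = 1 := rfl
  rw [hnil, mul_one] at hz'
  -- The list identity is this equation times the squared product over the odd numbers, which is a
  -- unit.
  have key : (1 - X ^ s) * (oneSubs A * F (K + 2) 1 - toSeries P) = toSeries R := by
    apply hu.mul_left_cancel
    linear_combination (1 - X ^ s) * oneSubs A * hF + hz'
  have hQ := coeff_nonneg_of_one_sub_mul hs (f := oneSubs A * F (K + 2) 1 - toSeries P)
    (by rw [key]; exact hR)
  refine coeff_nonneg_of_oneSubs_mul hA (fun m => ?_) n
  have := hQ m
  rw [map_sub] at this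
  linarith [hP m]

/-- The first `n` coefficients of `(∏ (1 - X ^ a)) * F (K + 2) 1`, the product being over
`a` in `A`. -/
def quotL (K : ℕ) (A : List ℕ) (n : ℕ) : List ℤ :=
  (odds K ++ odds K).foldr (fun e l => divOneSub e n l)
    ((shiftL 1 (mulOneSubs A (finList (odds K) K 1))).take n)

/-- Checks the certificate in which `P` consists of the first `t` coefficients of
`(∏ (1 - X ^ a)) * F (K + 2) 1` and `R` of the `s` coefficients that follow. -/
def splitCertificate (K s : ℕ) (A : List ℕ) (t : ℕ) : Bool :=
  -- `quotL` only proposes the coefficients; `IsCertificate` checks the resulting identity exactly,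
  -- so no correctness proof of the division is needed.
  let Q := quotL K A (t + s)
  IsCertificate K s A (Q.take t) (shiftL t (Q.drop t))

end TwoColor

theorem theorem2 (k : ℕ) (hk : k ∈ ({8, 9, 10} : Set ℕ)) (n : ℕ) :
    0 ≤ PowerSeries.coeff n (TwoColor.F k 1) := by
  have main {K s : ℕ} {A : List ℕ} {t : ℕ} (hs : 1 ≤ s) (hA : ∀ a ∈ A, 1 ≤ a)
      (h : TwoColor.splitCertificate K s A t = true) :
      0 ≤ PowerSeries.coeff n (TwoColor.F (K + 2) 1) :=
    TwoColor.coeff_F_nonneg_of_isCertificate hs hA h n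
  simp only [Set.mem_insert_iff, Set.mem_singleton_iff] at hk
  rcases hk with rfl | rfl | rfl
  -- In each case the quotient's coefficients have period $s$ from degree $t$ on, so $P$ is the
  -- initial segment and $R$ one full period.
  · exact main (K := 6) (s := 35) (A := [13, 13, 11, 11, 9, 9, 7]) (t := 110)
      (by norm_num) (by decide) (by decide +kernel)
  · exact main (K := 7) (s := 9) (A := [13, 13, 11, 11, 9, 15, 15, 35]) (t := 131)
      (by norm_num) (by decide) (by decide +kernel)
  · exact main (K := 8) (s := 9) (A := [17, 17, 13, 13, 11, 55, 63, 15, 15]) (t := 228)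
      (by norm_num) (by decide) (by decide +kernel)
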